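/- Let $\Delta=\{\mathbf e,\mathbf n,\mathbf w,\mathbf s\}$ with $\mathbf e=(1,0)$, $\mathbf n=(0,1)$, $\mathbf w=-\mathbf e$, $\mathbf s=-\mathbf n$. Given a stochastic matrix $\omega_x=(\omega_x(d,d'))_{d,d'\in\Delta}$ for each $x\in\mathbb Z^2$, the persistent random walk in the environment $\omega$ with initial condition $\xi=(x_0,d_0)\in\mathbb Z^2\times\Delta$ is the Markov chain $(X_n,D_n)_{n\ge 0}$ on $\mathbb Z^2\times\Delta$ with law $P_\xi$ that starts at $(X_0,D_0)=\xi$ and jumps from $(x,d)$ to $(x+d',d')$ with probability $\omega_x(d,d')$, for $d'\in\Delta$. It is called recurrent for the initial condition $\xi$ if $P_\xi\{(X_n,D_n)=\xi\text{ for some }n>0\}=1$, and non-recurrent for $\xi$ if this probability is less than $1$. The walk has asymptotic velocity $v\in\mathbb R^2$ if, for every initial condition $\xi$, $\lim_{n\to\infty}X_n/n=v$ $P_\xi$-almost surely. For $d\in\Delta$ let Forward be $d$, Left be $d$ rotated by $+90^\circ$, Right be $d$ rotated by $-90^\circ$, and Backward be $-d$. Call $x=(x^1,x^2)\in\mathbb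 Z^2$ even if $x^1+x^2$ is even, and odd otherwise. Let $(\zeta_x)_{x\in\mathbb Z^2}$ be numbers in $[0,1]$ and let $\omega$ be the following environment. If $x$ is even and $d\in\{\mathbf n,\mathbf s\}$, then $\omega_x(d,\cdot)$ gives probability $\zeta_x$ to Forward, $(1-\zeta_x)/2$ to each of Left and Right, and $0$ to Backward. In all other cases (that is, $x$ even and $d\in\{\mathbf e,\mathbf w\}$, or $x$ odd and $d\in\Delta$ arbitrary), $\omega_x(d,\cdot)$ gives probability $1/2$ to each of Left and Right, and $0$ to Forward and Backward. **Proposition.** Suppose that $\zeta_x>0$ for at least one even $x\in\mathbb Z^2$. Then the walk is recurrent for the initial condition $\xi=(x_0,d_0)$ if $$x_0\text{ is even and }d_0\in\{\mathbf e,\mathbf w\},\qquad\text{or}\qquad x_0\text{ is odd and }d_0\in\{\mathbf n,\mathbf s\},$$ and it is non-recurrent for every other initial condition. Moreover, the walk has asymptotic velocity zero: for every initial condition $\xi$, $X_n/n\to 0$ $P_\xi$-almost surely. -/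

import Mathlib

open MeasureTheory ProbabilityTheory Filter Topology

namespace PersistentWalk

/-- The four lattice directions `Δ = {±e₁, ±e₂}`. -/
inductive Dir
  | east | north | west | south
  deriving DecidableEq

namespace Dir

instance : Fintype Dir where
  elems := {east, north, west, south}
  complete d := by cases d <;> decide

/-- The unit vector of `ℤ²` that a direction stands for. -/
def vec : Dir → ℤ × ℤ
  | east => (1, 0)
  | north => (0, 1)
  | west => (-1, 0)
  | south => (0, -1)

/-- The direction obtained by a counterclockwise quarter turn. -/
def left : Dir → Dir
  | east => north
  | north => west
  | west => south
  | south => east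

/-- The direction obtained by a clockwise quarter turn. -/
def right : Dir → Dir
  | east => south
  | south => west
  | west => north
  | north => east

/-- Forward: the direction itself. (Backward is the only remaining relative direction.) -/
def forward (d : Dir) : Dir := d

/-- All sets of directions are measurable. -/
instance : MeasurableSpace Dir := ⊤

instance : DiscreteMeasurableSpace Dir := ⟨fun _ => trivial⟩

end Dir

/-- States of a persistent walk: the current site and the direction of the last jump. -/
abbrev State : Type := (ℤ × ℤ) × Dir

/-- Environments: a stochastic `4 × 4` matrix, indexed by the directions, at each site. -/
abbrev Env : Type := ℤ × ℤ → Matrix.rowStochastic ℝ Dir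

/-- The law of the next direction, given the current state. -/
noncomputable def nextDir (ω : Env) (s : State) : PMF Dir :=
  PMF.ofFintype (fun d' => ENNReal.ofReal ((ω s.1 : Matrix Dir Dir ℝ) s.2 d')) (by
    rw [← ENNReal.ofReal_sum_of_nonneg
        (fun i _ => Matrix.nonneg_of_mem_rowStochastic (ω s.1).2),
      Matrix.sum_row_of_mem_rowStochastic (ω s.1).2, ENNReal.ofReal_one])

/-- One step of the chain: from `(x, d)`, choose `d'` with probability `ω_x(d, d')` and
go to `(x + d', d')`. -/
noncomputable def nextState (ω : Env) (s : State) : PMF State :=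
  (nextDir ω s).map fun d' => (s.1 + d'.vec, d')

/-- The transition kernel of the chain on `ℤ² × Δ`. -/
noncomputable def stepKernel (ω : Env) : Kernel State State where
  toFun s := (nextState ω s).toMeasure
  measurable' := measurable_of_countable _

instance (ω : Env) : IsMarkovKernel (stepKernel ω) :=
  ⟨fun s => inferInstanceAs (IsProbabilityMeasure (nextState ω s).toMeasure)⟩

/-- The transition kernel as a kernel from histories: only the last state matters. -/
noncomputable def historyKernel (ω : Env) (n : ℕ) :
    Kernel ((i : Finset.Iic n) → (fun _ : ℕ => State) i) State :=
  (stepKernel ω).comap (fun h => h ⟨n, Finset.mem_Iic.2 le_rfl⟩) (measurable_pi_apply _)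

instance (ω : Env) (n : ℕ) : IsMarkovKernel (historyKernel ω n) := by
  unfold historyKernel; infer_instance

/-- The law `P_ξ^ω`, on paths `n ↦ (X_n, D_n)`, of the persistent random walk in the environment
`ω` with initial condition `ξ`. -/
noncomputable def pathLaw (ω : Env) (ξ : State) : Measure (ℕ → State) :=
  Kernel.traj (X := fun _ : ℕ => State) (historyKernel ω) 0 (fun _ => ξ)

/-- The walk in `ω` started from `ξ` is recurrent: almost surely it comes back to `ξ`. -/
def RecurrentFrom (ω : Env) (ξ : State) : Prop :=
  pathLaw ω ξ {Z | ∃ n : ℕ, 0 < n ∧ Z n = ξ} = 1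

/-- The walk in `ω` has asymptotic velocity `v`: for every initial condition, `X_n / n → v`
almost surely. -/
def HasAsymptoticVelocity (ω : Env) (v : ℝ × ℝ) : Prop :=
  ∀ ξ : State, ∀ᵐ Z ∂(pathLaw ω ξ),
    Tendsto (fun n : ℕ => (((Z n).1.1 : ℝ) / (n : ℝ), ((Z n).1.2 : ℝ) / (n : ℝ))) atTop (𝓝 v)

/-- The even sublattice of `ℤ²`. -/
def EvenSite (x : ℤ × ℤ) : Prop := Even (x.1 + x.2)

instance : DecidablePred EvenSite := fun x => inferInstanceAs (Decidable (Even (x.1 + x.2)))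

/-- The `4 × 4` matrix with Forward probability `f d`, Left and Right probabilities
`(1 - f d) / 2`, and Backward probability `0`. -/
noncomputable def forwardMatrix (f : Dir → ℝ) : Matrix Dir Dir ℝ :=
  Matrix.of fun d d' =>
    if d' = d.forward then f d
    else if d' = d.left ∨ d' = d.right then (1 - f d) / 2
    else 0

/-- The Forward probability at the site `x` for a walker arriving with direction `d`:
`ζ_x` if `x` is even and `d` is North or South, and `0` in all other cases. -/
noncomputable def forwardProb (ζ : ℤ × ℤ → Set.Icc (0 : ℝ) 1) (x : ℤ × ℤ) (d : Dir) : ℝ :=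
  if EvenSite x ∧ (d = Dir.north ∨ d = Dir.south) then (ζ x : ℝ) else 0

theorem forwardMatrix_mem (f : Dir → ℝ) (hf : ∀ d, f d ∈ Set.Icc (0 : ℝ) 1) :
    forwardMatrix f ∈ Matrix.rowStochastic ℝ Dir := by
  rw [Matrix.mem_rowStochastic_iff_sum]
  constructor
  · intro d d'
    have h0 := (hf d).1
    have h1 := (hf d).2
    simp only [forwardMatrix, Matrix.of_apply]
    split_ifs <;> linarith
  · intro d
    have hu : (Finset.univ : Finset Dir) = {Dir.east, Dir.north, Dir.west, Dir.south} := rfl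
    cases d <;>
      simp [hu, forwardMatrix, Dir.forward, Dir.left, Dir.right] <;> ring

theorem forwardProb_mem (ζ : ℤ × ℤ → Set.Icc (0 : ℝ) 1) (x : ℤ × ℤ) (d : Dir) :
    forwardProb ζ x d ∈ Set.Icc (0 : ℝ) 1 := by
  unfold forwardProb
  split_ifs
  · exact (ζ x).2
  · simp

/-- The environment in which the walker may go Forward (with probability `ζ_x`) only when it
arrives from the North or the South at an even site `x`, and otherwise turns Left or Right with
equal probabilities. -/
noncomputable def northSouthEnv (ζ : ℤ × ℤ → Set.Icc (0 : ℝ) 1) : Env :=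
  fun x => ⟨forwardMatrix (forwardProb ζ x), forwardMatrix_mem _ (forwardProb_mem ζ x)⟩

end PersistentWalk

/-!
Call a state turning if it is at an even site with a horizontal direction or at an odd site with a
vertical one. From a turning state the walker turns left or right with probability `1/2` each, and
arrives at a turning state again. Two consecutive turns move the two coordinates by independent
fair signs, so the walk observed at even times is a pair of independent simple random walks; its
return probabilities at the times `4 m + 4` are at least of order `1 / m`, hence not summable, and
the walk is recurrent.

From a non-turning state the walker either turns, staying non-turning, or goes forward and becomes
turning for ever. Some turning state is accessible as soon as `ζ x > 0` at one even site `x`, since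
the walker can approach `x` by alternating turns until it can go forward. A non-turning
starting point is therefore abandoned with positive probability.

A walk goes forward at most once, and its other steps are symmetric. For a coordinate `c` the
exponential moment `exp (l c)`, corrected by a factor `exp |l|` until the forward step, therefore
grows by at most the factor `cosh l ≤ exp (l² / 2)` in each step. Chernoff's bound and the
Borel–Cantelli lemma give velocity zero.
-/

open scoped ENNReal

namespace PersistentWalk

theorem dependsOn_prod_eval {ι E M : Type*} [CommMonoid M] {s : Finset ι} {τ : ι → ℕ} {n : ℕ}
    (hτ : ∀ i ∈ s, τ i ≤ n) (g : ι → E → M) :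
    DependsOn (fun Z : ℕ → E => ∏ i ∈ s, g i (Z (τ i))) (Set.Iic n) :=
  fun _ _ h => Finset.prod_congr rfl fun i hi => by rw [h (τ i) (hτ i hi)]

theorem prod_range_succ_update_mul {E M : Type*} [CommMonoid M] (n : ℕ) (g : ℕ → E → M)
    (h : E → M) (w : ℕ → E) :
    ∏ i ∈ Finset.range (n + 1), Function.update g n (g n * h) i (w i) =
      (∏ i ∈ Finset.range (n + 1), g i (w i)) * h (w n) := by
  rw [Finset.prod_range_succ, Finset.prod_range_succ, Function.update_self, Pi.mul_apply,
    mul_assoc]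
  congr 1
  exact Finset.prod_congr rfl fun i hi => by
    rw [Function.update_of_ne (Finset.mem_range.1 hi).ne]

theorem measure_ext_of_lintegral_prod_eval {E : Type*} [MeasurableSpace E] {μ ν : Measure (ℕ → E)}
    [IsProbabilityMeasure μ] [IsProbabilityMeasure ν]
    (h : ∀ (n : ℕ) (g : ℕ → E → ℝ≥0∞), (∀ i, Measurable (g i)) →
      ∫⁻ Z, ∏ i ∈ Finset.range (n + 1), g i (Z i) ∂μ =
        ∫⁻ Z, ∏ i ∈ Finset.range (n + 1), g i (Z i) ∂ν) :
    μ = ν := by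
  classical
  refine MeasureTheory.ext_of_generate_finite _ generateFrom_squareCylinders.symm
    (isPiSystem_squareCylinders (fun _ => MeasurableSpace.isPiSystem_measurableSet)
      fun _ => MeasurableSet.univ) ?_ (by simp only [measure_univ])
  rintro _ ⟨s, t, ht, rfl⟩
  have ht' (i : ℕ) : MeasurableSet (t i) := ht i trivial
  let g (i : ℕ) : E → ℝ≥0∞ := if i ∈ s then (t i).indicator 1 else 1
  have hg (i : ℕ) : Measurable (g i) := by
    by_cases hi : i ∈ s <;> simp only [g, hi, if_true, if_false]
    exacts [measurable_one.indicator (ht' i), measurable_one]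
  have hs : s ⊆ Finset.range (s.sup id + 1) := fun i hi =>
    Finset.mem_range_succ_iff.2 (Finset.le_sup (f := id) hi)
  have h_prod (Z : ℕ → E) : ∏ i ∈ Finset.range (s.sup id + 1), g i (Z i) =
      ((s : Set ℕ).pi t).indicator 1 Z := by
    rw [Set.indicator_pi_one_apply, ← Finset.prod_subset hs fun i _ hi => by simp [g, hi]]
    exact Finset.prod_congr rfl fun i hi => by simp only [g, hi, if_true]
  have h_meas : MeasurableSet ((s : Set ℕ).pi t) :=
    MeasurableSet.pi s.countable_toSet fun i _ => ht' i
  simpa only [h_prod, lintegral_indicator_one h_meas] using h (s.sup id) g hg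

section MarkovChain

variable {E : Type*} [MeasurableSpace E]

/-- A set of states that the chain almost surely does not leave in one step. -/
def IsAbsorbing (κ : Kernel E E) (C : Set E) : Prop :=
  ∀ x ∈ C, ∀ᵐ y ∂κ x, y ∈ C

theorem IsAbsorbing.ae_pow {κ : Kernel E E} {C : Set E} (hC : IsAbsorbing κ C)
    (hCm : MeasurableSet C) {x : E} (hx : x ∈ C) (n : ℕ) : ∀ᵐ y ∂(κ ^ n) x, y ∈ C := by
  induction n generalizing x with
  | zero => exact (ae_dirac_iff hCm).2 hx
  | succ n ih =>
    rw [pow_succ]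
    exact Kernel.ae_comp_of_ae_ae hCm ((hC x hx).mono fun y hy => ih hy)

/-- The state `z` can be reached from `x` by finitely many jumps of positive probability. -/
def IsAccessible (κ : Kernel E E) : E → E → Prop :=
  Relation.ReflTransGen fun x z => 0 < κ x {z}

theorem mul_pow_apply_le_pow_add_apply (κ : Kernel E E) {A B : Set E} {c : ℝ≥0∞} {m n : ℕ}
    (hA : MeasurableSet A) (hB : MeasurableSet B) (h : ∀ y ∈ A, c ≤ (κ ^ n) y B) (x : E) :
    c * (κ ^ m) x A ≤ (κ ^ (m + n)) x B := by
  rw [Kernel.pow_add_apply_eq_lintegral κ m n x hB, ← setLIntegral_const]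
  exact (setLIntegral_mono' hA h).trans (setLIntegral_le_lintegral _ _)

/-- The transition kernels, as kernels from histories, of the Markov chain that moves according to
`κ`: only the last state matters. -/
noncomputable def chainStep (κ : Kernel E E) (n : ℕ) :
    Kernel ((i : Finset.Iic n) → (fun _ : ℕ => E) i) E :=
  κ.comap (fun h => h ⟨n, Finset.mem_Iic.2 le_rfl⟩) (measurable_pi_apply _)

instance (κ : Kernel E E) [IsMarkovKernel κ] (n : ℕ) : IsMarkovKernel (chainStep κ n) := by
  unfold chainStep; infer_instance

/-- The law of the trajectory of the Markov chain with transition kernel `κ`, as a kernel from the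
initial state. -/
noncomputable def chainLaw (κ : Kernel E E) [IsMarkovKernel κ] : Kernel E (ℕ → E) :=
  (Kernel.traj (X := fun _ : ℕ => E) (chainStep κ) 0).comap (fun x _ => x) (by fun_prop)

variable (κ : Kernel E E) [IsMarkovKernel κ]

instance : IsMarkovKernel (chainLaw κ) := by
  unfold chainLaw; infer_instance

theorem chainLaw_map_eval_zero : (chainLaw κ).map (fun Z => Z 0) = Kernel.id := by
  ext1 x
  have h := Kernel.traj_map_frestrictLe_apply (X := fun _ : ℕ => E) (κ := chainStep κ) 0 0
    (fun _ => x)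
  rw [Kernel.partialTraj_self, Kernel.id_apply] at h
  have h' := congrArg (Measure.map fun p => p ⟨0, Finset.mem_Iic.2 le_rfl⟩) h
  rw [Measure.map_map (by fun_prop) (by fun_prop), Measure.map_dirac' (by fun_prop)] at h'
  rwa [Kernel.map_apply _ (by fun_prop), Kernel.id_apply]

theorem lintegral_mul_eval_succ_chainLaw (x : E) {n : ℕ} {F : (ℕ → E) → ℝ≥0∞}
    (hF : Measurable F) (hFn : DependsOn F (Set.Iic n)) {g : E → ℝ≥0∞} (hg : Measurable g) :
    ∫⁻ Z, F Z * g (Z (n + 1)) ∂chainLaw κ x =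
      ∫⁻ Z, F Z * ∫⁻ y, g y ∂κ (Z n) ∂chainLaw κ x := by
  let extend : ((i : Finset.Iic n) → E) → ℕ → E :=
    fun h i => if hi : i ≤ n then h ⟨i, Finset.mem_Iic.2 hi⟩ else x
  have h_extend : Measurable extend := by
    refine measurable_pi_lambda _ fun i => ?_
    by_cases hi : i ≤ n <;> simp only [extend, hi, dite_true, dite_false] <;> fun_prop
  have hF_extend (Z : ℕ → E) :
      F (extend (Preorder.frestrictLe (π := fun _ => E) n Z)) = F Z :=
    hFn fun i hi => by simp [extend, Set.mem_Iic.1 hi]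
  have : Measurable fun y => ∫⁻ z, g z ∂κ y := hg.lintegral_kernel
  have h_law := Kernel.partialTraj_compProd_eq_map_traj (X := fun _ : ℕ => E)
    (κ := chainStep κ) (Nat.zero_le n) (x₀ := fun _ => x)
  have h_lintegral := congrArg (lintegral · fun p => F (extend p.1) * g p.2) h_law
  rw [Measure.lintegral_compProd (by fun_prop), lintegral_map (by fun_prop) (by fun_prop),
    ← Kernel.traj_map_frestrictLe_apply, lintegral_map _ (by fun_prop)] at h_lintegral
  · simp only [hF_extend] at h_lintegral
    refine h_lintegral.symm.trans (lintegral_congr fun Z => ?_)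
    rw [lintegral_const_mul _ hg]
    rfl
  · exact (Measurable.lintegral_kernel_prod_right'
      (f := fun p : ((i : Finset.Iic n) → E) × E => F (extend p.1) * g p.2) (by fun_prop))

theorem lintegral_eval_zero_chainLaw (x : E) {f : E → ℝ≥0∞} (hf : Measurable f) :
    ∫⁻ Z, f (Z 0) ∂chainLaw κ x = f x := by
  rw [← lintegral_map hf (measurable_pi_apply 0), ← Kernel.map_apply _ (measurable_pi_apply 0),
    chainLaw_map_eval_zero, Kernel.id_apply, lintegral_dirac' _ hf]

theorem lintegral_prod_shift_chainLaw (x : E) (n : ℕ) {g : ℕ → E → ℝ≥0∞}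
    (hg : ∀ i, Measurable (g i)) :
    ∫⁻ Z, ∏ i ∈ Finset.range (n + 1), g i (Z (i + 1)) ∂chainLaw κ x =
      ∫⁻ y, ∫⁻ Z, ∏ i ∈ Finset.range (n + 1), g i (Z i) ∂chainLaw κ y ∂κ x := by
  induction n generalizing g with
  | zero =>
    have h := lintegral_mul_eval_succ_chainLaw κ x (n := 0) (F := 1) measurable_const
      (fun _ _ _ => rfl) (hg 0)
    simp only [Pi.one_apply, one_mul, zero_add] at h
    simp only [zero_add, Finset.prod_range_one, h,
      lintegral_eval_zero_chainLaw κ _ (hg 0).lintegral_kernel,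
      lintegral_eval_zero_chainLaw κ _ (hg 0)]
  | succ n ih =>
    let h : E → ℝ≥0∞ := fun y => ∫⁻ z, g (n + 1) z ∂κ y
    let g' := Function.update g n (g n * h)
    have hg' (i : ℕ) : Measurable (g' i) := by
      rcases eq_or_ne i n with rfl | hi
      · simpa only [g', Function.update_self] using (hg i).mul (hg (i + 1)).lintegral_kernel
      · simpa only [g', Function.update_of_ne hi] using hg i
    calc ∫⁻ Z, ∏ i ∈ Finset.range (n + 2), g i (Z (i + 1)) ∂chainLaw κ x
      _ = ∫⁻ Z, ∏ i ∈ Finset.range (n + 1), g' i (Z (i + 1)) ∂chainLaw κ x := by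
        simp only [Finset.prod_range_succ _ (n + 1), g',
          prod_range_succ_update_mul n g h fun _ => _]
        exact lintegral_mul_eval_succ_chainLaw κ x (by fun_prop)
          (dependsOn_prod_eval (fun i hi => Finset.mem_range.1 hi) g) (hg (n + 1))
      _ = ∫⁻ y, ∫⁻ Z, ∏ i ∈ Finset.range (n + 1), g' i (Z i) ∂chainLaw κ y ∂κ x := ih hg'
      _ = ∫⁻ y, ∫⁻ Z, ∏ i ∈ Finset.range (n + 2), g i (Z i) ∂chainLaw κ y ∂κ x := by
        refine lintegral_congr fun y => ?_
        simp only [Finset.prod_range_succ _ (n + 1), g', prod_range_succ_update_mul n g h]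
        exact (lintegral_mul_eval_succ_chainLaw κ y (by fun_prop)
          (dependsOn_prod_eval (fun i hi => Finset.mem_range_succ_iff.1 hi) g) (hg (n + 1))).symm

theorem chainLaw_map_shift_one :
    (chainLaw κ).map (fun Z n => Z (n + 1)) = chainLaw κ ∘ₖ κ := by
  have h_shift : Measurable fun (Z : ℕ → E) n => Z (n + 1) := by fun_prop
  ext1 x
  rw [Kernel.map_apply _ h_shift]
  have := Measure.isProbabilityMeasure_map (μ := chainLaw κ x) h_shift.aemeasurable
  refine measure_ext_of_lintegral_prod_eval fun n g hg => ?_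
  rw [lintegral_map (by fun_prop) h_shift, Kernel.lintegral_comp _ _ _ (by fun_prop)]
  exact lintegral_prod_shift_chainLaw κ x n hg

theorem chainLaw_map_shift (k : ℕ) :
    (chainLaw κ).map (fun Z n => Z (n + k)) = chainLaw κ ∘ₖ (κ ^ k) := by
  induction k with
  | zero => exact (Kernel.map_id _).trans (Kernel.comp_id _).symm
  | succ k ih =>
    have h_shift (m : ℕ) : Measurable fun (Z : ℕ → E) n => Z (n + m) := by fun_prop
    calc (chainLaw κ).map (fun Z n => Z (n + (k + 1)))
      _ = ((chainLaw κ).map fun Z n => Z (n + 1)).map (fun Z n => Z (n + k)) := by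
        rw [← Kernel.map_comp_right _ (h_shift 1) (h_shift k)]
        rfl
      _ = chainLaw κ ∘ₖ (κ ^ (k + 1)) := by
        rw [chainLaw_map_shift_one, Kernel.map_comp, ih, Kernel.comp_assoc, pow_succ]
        rfl

theorem chainLaw_map_eval (n : ℕ) : (chainLaw κ).map (fun Z => Z n) = κ ^ n := by
  have h_shift : Measurable fun (Z : ℕ → E) m => Z (m + n) := by fun_prop
  rw [← Kernel.id_comp (κ ^ n), ← chainLaw_map_eval_zero κ, ← Kernel.map_comp,
    ← chainLaw_map_shift, ← Kernel.map_comp_right _ h_shift (measurable_pi_apply 0)]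
  simp only [Function.comp_def, zero_add]

theorem ae_eval_chainLaw {p : E → Prop} (hp : MeasurableSet {y | p y}) (x : E) (n : ℕ) :
    (∀ᵐ Z ∂chainLaw κ x, p (Z n)) ↔ ∀ᵐ y ∂(κ ^ n) x, p y := by
  rw [← chainLaw_map_eval κ n, Kernel.map_apply _ (measurable_pi_apply n),
    ae_map_iff (f := fun Z : ℕ → E => Z n) (measurable_pi_apply n).aemeasurable hp]

theorem lintegral_eval_chainLaw (x : E) (n : ℕ) {f : E → ℝ≥0∞} (hf : Measurable f) :
    ∫⁻ Z, f (Z n) ∂chainLaw κ x = ∫⁻ y, f y ∂(κ ^ n) x := by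
  rw [← chainLaw_map_eval κ n, Kernel.map_apply _ (measurable_pi_apply n),
    lintegral_map hf (measurable_pi_apply n)]

section Visits

variable [MeasurableSingletonClass E]

/-- The probability that the chain started at `x` avoids `y` at all positive times. -/
noncomputable def escapeProb (y x : E) : ℝ≥0∞ :=
  chainLaw κ x {Z | ∀ n, 0 < n → Z n ≠ y}

theorem measurableSet_escape (y : E) : MeasurableSet {Z : ℕ → E | ∀ n, 0 < n → Z n ≠ y} := by
  measurability

theorem ae_eval_zero_chainLaw (x : E) : ∀ᵐ Z ∂chainLaw κ x, Z 0 = x :=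
  (ae_eval_chainLaw κ (measurableSet_singleton x) x 0).2
    ((ae_dirac_iff (measurableSet_singleton x)).2 rfl)

theorem chainLaw_lastVisit (x y : E) (n : ℕ) :
    chainLaw κ x {Z | Z n = y ∧ ∀ m, n < m → Z m ≠ y} =
      (κ ^ n) x {y} * escapeProb κ y y := by
  have h_shift : Measurable fun (Z : ℕ → E) m => Z (m + n) := by fun_prop
  have h_meas : MeasurableSet {Z : ℕ → E | Z 0 = y ∧ ∀ m, 0 < m → Z m ≠ y} := by
    measurability
  have h_start (z : E) : chainLaw κ z {Z | Z 0 = y ∧ ∀ m, 0 < m → Z m ≠ y} =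
      Set.indicator {y} (fun _ => escapeProb κ y y) z := by
    by_cases hz : z = y
    · subst hz
      rw [Set.indicator_of_mem (Set.mem_singleton z)]
      exact measure_congr ((ae_eval_zero_chainLaw κ z).mono fun Z hZ =>
        propext (and_iff_right hZ))
    · rw [Set.indicator_of_notMem (mt Set.mem_singleton_iff.1 hz), measure_eq_zero_iff_ae_notMem]
      exact (ae_eval_zero_chainLaw κ z).mono fun Z hZ h => hz (hZ.symm.trans h.1)
  have h_preimage : {Z : ℕ → E | Z n = y ∧ ∀ m, n < m → Z m ≠ y} =
      (fun Z m => Z (m + n)) ⁻¹' {Z | Z 0 = y ∧ ∀ m, 0 < m → Z m ≠ y} := by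
    ext Z
    simp only [Set.mem_ofPred_eq, Set.mem_preimage, zero_add]
    refine and_congr_right fun _ => ⟨fun h m hm => h _ (by lia), fun h m hm => ?_⟩
    simpa only [Nat.sub_add_cancel hm.le] using h (m - n) (Nat.sub_pos_of_lt hm)
  rw [h_preimage, ← Kernel.map_apply' _ h_shift _ h_meas, chainLaw_map_shift,
    Kernel.comp_apply' _ _ _ h_meas, lintegral_congr h_start,
    lintegral_indicator_const (measurableSet_singleton y), mul_comm]

theorem tsum_pow_mul_escapeProb_le_one (x y : E) :
    (∑' n, (κ ^ n) x {y}) * escapeProb κ y y ≤ 1 := by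
  rw [← ENNReal.tsum_mul_right, ← measure_univ (μ := chainLaw κ x)]
  simp_rw [← chainLaw_lastVisit κ x y]
  refine tsum_measure_le_measure_univ (fun n => ?_) fun m n hmn => ?_
  · exact MeasurableSet.nullMeasurableSet (by measurability)
  · refine Disjoint.aedisjoint (Set.disjoint_left.2 fun Z hm hn => ?_)
    rcases hmn.lt_or_gt with h | h
    exacts [hm.2 n h hn.1, hn.2 m h hm.1]

theorem escapeProb_eq_zero {x y : E} (h : ∑' n, (κ ^ n) x {y} = ∞) : escapeProb κ y y = 0 := by
  by_contra h0
  have := tsum_pow_mul_escapeProb_le_one κ x y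
  rw [h, ENNReal.top_mul h0] at this
  exact absurd this (by simp)

theorem mul_escapeProb_le_escapeProb {y z : E} (hzy : z ≠ y) (x : E) :
    κ x {z} * escapeProb κ y z ≤ escapeProb κ y x := by
  have h_shift : Measurable fun (Z : ℕ → E) n => Z (n + 1) := by fun_prop
  have h_meas : MeasurableSet {Z : ℕ → E | ∀ n, Z n ≠ y} := by measurability
  have h_escape : escapeProb κ y z = chainLaw κ z {Z | ∀ n, Z n ≠ y} :=
    measure_congr ((ae_eval_zero_chainLaw κ z).mono fun Z hZ => propext
      ⟨fun h n => n.eq_zero_or_pos.elim (fun hn => hn ▸ hZ ▸ hzy) (h n), fun h n _ => h n⟩)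
  have h_preimage : {Z : ℕ → E | ∀ n, 0 < n → Z n ≠ y} =
      (fun Z n => Z (n + 1)) ⁻¹' {Z | ∀ n, Z n ≠ y} := by
    ext Z
    exact ⟨fun h n => h (n + 1) n.succ_pos, fun h n hn => Nat.sub_add_cancel hn ▸ h (n - 1)⟩
  rw [escapeProb.eq_1 κ y x, h_preimage, ← Kernel.map_apply' _ h_shift _ h_meas,
    chainLaw_map_shift_one, Kernel.comp_apply' _ _ _ h_meas, h_escape, mul_comm,
    ← lintegral_singleton (fun w => chainLaw κ w {Z | ∀ n, Z n ≠ y}) z]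
  exact setLIntegral_le_lintegral _ _

variable {κ} in
theorem IsAbsorbing.escapeProb_eq_one {C : Set E} (hC : IsAbsorbing κ C) (hCm : MeasurableSet C)
    {x y : E} (hx : x ∈ C) (hy : y ∉ C) : escapeProb κ y x = 1 := by
  have h (n : ℕ) : ∀ᵐ Z ∂chainLaw κ x, Z n ∈ C :=
    (ae_eval_chainLaw κ hCm x n).2 (hC.ae_pow hCm hx n)
  rw [escapeProb, ← mem_ae_iff_prob_eq_one (measurableSet_escape y)]
  exact (ae_all_iff.2 h).mono fun Z hZ n _ hn => hy (hn ▸ hZ n)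

variable {κ} in
theorem IsAccessible.escapeProb_pos {y z : E} (h : IsAccessible κ y z)
    (hz : 0 < escapeProb κ y z) : 0 < escapeProb κ y y := by
  by_contra! h0
  have h_pos (w : E) (hw : IsAccessible κ w z) : 0 < escapeProb κ y w := by
    induction hw using Relation.ReflTransGen.head_induction_on with
    | refl => exact hz
    | @head w v hwv _ hv =>
      have hvy : v ≠ y := by
        rintro rfl
        exact hv.not_ge h0
      exact (ENNReal.mul_pos hwv.ne' hv.ne').trans_le (mul_escapeProb_le_escapeProb κ hvy _)
  exact (h_pos y h).not_ge h0

end Visits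

section LinearGrowth

/-- `V` is a Lyapunov function for the exponential moment of order `l` of the observable `φ`: it
dominates `exp (l φ)` and its mean grows by at most the factor `exp (l² / 2)` in each step. -/
structure IsExpLyapunov (κ : Kernel E E) (φ : E → ℝ) (l : ℝ) (V : E → ℝ≥0∞) : Prop where
  measurable : Measurable V
  ne_top : ∀ x, V x ≠ ∞
  exp_le : ∀ x, ENNReal.ofReal (Real.exp (l * φ x)) ≤ V x
  lintegral_le : ∀ x, ∫⁻ y, V y ∂κ x ≤ ENNReal.ofReal (Real.exp (l ^ 2 / 2)) * V x

namespace IsExpLyapunov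

variable {κ : Kernel E E} {φ : E → ℝ} {l : ℝ} {V : E → ℝ≥0∞}

theorem lintegral_pow_le (hV : IsExpLyapunov κ φ l V) (x : E) (n : ℕ) :
    ∫⁻ y, V y ∂(κ ^ n) x ≤ ENNReal.ofReal (Real.exp (l ^ 2 / 2)) ^ n * V x := by
  induction n with
  | zero =>
    rw [pow_zero, pow_zero, one_mul]
    exact (lintegral_dirac' x hV.measurable).le
  | succ n ih =>
    calc ∫⁻ y, V y ∂(κ ^ (n + 1)) x
      _ = ∫⁻ y, ∫⁻ z, V z ∂κ y ∂(κ ^ n) x := by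
        rw [pow_succ']
        exact Kernel.lintegral_comp _ _ _ hV.measurable
      _ ≤ ∫⁻ y, ENNReal.ofReal (Real.exp (l ^ 2 / 2)) * V y ∂(κ ^ n) x :=
        lintegral_mono hV.lintegral_le
      _ = ENNReal.ofReal (Real.exp (l ^ 2 / 2)) * ∫⁻ y, V y ∂(κ ^ n) x :=
        lintegral_const_mul _ hV.measurable
      _ ≤ ENNReal.ofReal (Real.exp (l ^ 2 / 2)) ^ (n + 1) * V x := by
        rw [pow_succ' _ n, mul_assoc]
        gcongr

variable [IsMarkovKernel κ]

theorem chainLaw_deviation_le (hV : IsExpLyapunov κ φ l V) (x : E) (n : ℕ) :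
    chainLaw κ x {Z | l ^ 2 * n ≤ l * φ (Z n)} ≤
      V x * ENNReal.ofReal (Real.exp (-(l ^ 2 / 2))) ^ n := by
  have hVm := hV.measurable
  have h_subset : {Z : ℕ → E | l ^ 2 * n ≤ l * φ (Z n)} ⊆
      {Z | ENNReal.ofReal (Real.exp (l ^ 2 * n)) ≤ V (Z n)} := fun Z hZ =>
    (ENNReal.ofReal_le_ofReal (Real.exp_le_exp.2 hZ)).trans (hV.exp_le _)
  calc chainLaw κ x {Z | l ^ 2 * n ≤ l * φ (Z n)}
    _ ≤ (∫⁻ Z, V (Z n) ∂chainLaw κ x) / ENNReal.ofReal (Real.exp (l ^ 2 * n)) :=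
      (measure_mono h_subset).trans (meas_ge_le_lintegral_div
        (hVm.comp (measurable_pi_apply n)).aemeasurable
        (ENNReal.ofReal_pos.2 (Real.exp_pos _)).ne' ENNReal.ofReal_ne_top)
    _ ≤ ENNReal.ofReal (Real.exp (l ^ 2 / 2)) ^ n * V x /
        ENNReal.ofReal (Real.exp (l ^ 2 * n)) := by
      rw [lintegral_eval_chainLaw κ x n hVm]
      gcongr
      exact hV.lintegral_pow_le x n
    _ = V x * ENNReal.ofReal (Real.exp (-(l ^ 2 / 2))) ^ n := by
      rw [mul_comm, mul_div_assoc, ← ENNReal.ofReal_pow (Real.exp_pos _).le,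
        ← ENNReal.ofReal_pow (Real.exp_pos _).le, ← Real.exp_nat_mul, ← Real.exp_nat_mul,
        ← ENNReal.ofReal_div_of_pos (Real.exp_pos _), ← Real.exp_sub]
      ring_nf

theorem ae_eventually_lt (hV : IsExpLyapunov κ φ l V) (hl : l ≠ 0) (x : E) :
    ∀ᵐ Z ∂chainLaw κ x, ∀ᶠ n : ℕ in atTop, l * φ (Z n) < l ^ 2 * n := by
  have h_lt_one : ENNReal.ofReal (Real.exp (-(l ^ 2 / 2))) < 1 := by
    rw [ENNReal.ofReal_lt_one, Real.exp_lt_one_iff, neg_lt_zero]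
    positivity
  have h_geometric : ∑' n : ℕ, V x * ENNReal.ofReal (Real.exp (-(l ^ 2 / 2))) ^ n ≠ ∞ := by
    rw [ENNReal.tsum_mul_left, ENNReal.tsum_geometric]
    exact ENNReal.mul_ne_top (hV.ne_top x) (ENNReal.inv_ne_top.2 (tsub_pos_of_lt h_lt_one).ne')
  have h_summable : ∑' n : ℕ, chainLaw κ x {Z | l ^ 2 * n ≤ l * φ (Z n)} ≠ ∞ :=
    ne_top_of_le_ne_top h_geometric (ENNReal.tsum_le_tsum (hV.chainLaw_deviation_le x))
  filter_upwards [ae_eventually_notMem h_summable] with Z hZ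
  exact hZ.mono fun n => not_le.1

end IsExpLyapunov

theorem ae_tendsto_div_zero_of_isExpLyapunov {φ : E → ℝ}
    (h : ∀ l : ℝ, ∃ V, IsExpLyapunov κ φ l V) (x : E) :
    ∀ᵐ Z ∂chainLaw κ x, Tendsto (fun n : ℕ => φ (Z n) / n) atTop (𝓝 0) := by
  choose V hV using h
  have hk (k : ℕ) : (0 : ℝ) < 1 / (k + 1) := Nat.one_div_pos_of_nat
  filter_upwards [ae_all_iff.2 fun k : ℕ => (hV (1 / (k + 1))).ae_eventually_lt (hk k).ne' x,
    ae_all_iff.2 fun k : ℕ => (hV (-(1 / (k + 1)))).ae_eventually_lt (neg_ne_zero.2 (hk k).ne') x]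
    with Z h_upper h_lower
  rw [NormedAddGroup.tendsto_nhds_zero]
  intro ε hε
  obtain ⟨k, hkε⟩ := exists_nat_one_div_lt hε
  filter_upwards [h_upper k, h_lower k, eventually_gt_atTop 0] with n h_up h_low hn
  have hn : (0 : ℝ) < n := Nat.cast_pos.2 hn
  have h_abs : |φ (Z n)| < 1 / (k + 1) * n := abs_lt.2 ⟨by nlinarith [hk k], by nlinarith [hk k]⟩
  rw [Real.norm_eq_abs, abs_div, abs_of_pos hn, div_lt_iff₀ hn]
  exact h_abs.trans (mul_lt_mul_of_pos_right hkε hn)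

end LinearGrowth

end MarkovChain

theorem pathLaw_eq_chainLaw (ω : Env) (ξ : State) : pathLaw ω ξ = chainLaw (stepKernel ω) ξ := rfl

theorem recurrentFrom_iff_escapeProb_eq_zero (ω : Env) (ξ : State) :
    RecurrentFrom ω ξ ↔ escapeProb (stepKernel ω) ξ ξ = 0 := by
  have h_compl : {Z : ℕ → State | ∃ n : ℕ, 0 < n ∧ Z n = ξ} =
      {Z | ∀ n : ℕ, 0 < n → Z n ≠ ξ}ᶜ := by
    ext Z
    simp only [Set.mem_compl_iff, Set.mem_ofPred_eq]
    push Not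
    rfl
  rw [RecurrentFrom, pathLaw_eq_chainLaw, h_compl, prob_compl_eq_one_iff (measurableSet_escape ξ),
    escapeProb]

theorem lintegral_stepKernel (ω : Env) (s : State) (f : State → ℝ≥0∞) :
    ∫⁻ t, f t ∂stepKernel ω s =
      ∑ d, ENNReal.ofReal ((ω s.1 : Matrix Dir Dir ℝ) s.2 d) * f (s.1 + d.vec, d) := by
  have h : stepKernel ω s = ((nextDir ω s).map fun d => (s.1 + d.vec, d)).toMeasure := rfl
  rw [h, ← PMF.toMeasure_map _ _ (measurable_of_countable _),
    lintegral_map (measurable_of_countable _) (measurable_of_countable _), lintegral_fintype]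
  refine Finset.sum_congr rfl fun d _ => ?_
  rw [PMF.toMeasure_apply_singleton _ _ (measurableSet_singleton _), mul_comm]
  rfl

theorem lintegral_stepKernel_northSouthEnv (ζ : ℤ × ℤ → Set.Icc (0 : ℝ) 1) (x : ℤ × ℤ) (d : Dir)
    (f : State → ℝ≥0∞) :
    ∫⁻ t, f t ∂stepKernel (northSouthEnv ζ) (x, d) =
      ENNReal.ofReal (forwardProb ζ x d) * f (x + d.vec, d) +
        ENNReal.ofReal ((1 - forwardProb ζ x d) / 2) *
          (f (x + d.left.vec, d.left) + f (x + d.right.vec, d.right)) := by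
  have hu : (Finset.univ : Finset Dir) = {Dir.east, Dir.north, Dir.west, Dir.south} := rfl
  rw [lintegral_stepKernel]
  cases d <;>
    simp [northSouthEnv, hu, forwardMatrix, Dir.forward, Dir.left, Dir.right] <;> ring

theorem Dir.vec_right (d : Dir) : d.right.vec = -d.left.vec := by
  cases d <;> rfl

theorem evenSite_add_vec (x : ℤ × ℤ) (d : Dir) : EvenSite (x + d.vec) ↔ ¬ EvenSite x := by
  cases d <;> simp only [EvenSite, Dir.vec, Prod.fst_add, Prod.snd_add] <;> grind

/-- The states in which the walker is bound to turn, now and at all later times. -/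
def TurningState (s : State) : Prop :=
  (EvenSite s.1 ∧ (s.2 = Dir.east ∨ s.2 = Dir.west)) ∨
    (¬ EvenSite s.1 ∧ (s.2 = Dir.north ∨ s.2 = Dir.south))

instance : DecidablePred TurningState := fun _ => instDecidableOr

theorem turningState_turn (x : ℤ × ℤ) {d d' : Dir} (hd : d' = d.left ∨ d' = d.right) :
    TurningState (x + d'.vec, d') ↔ TurningState (x, d) := by
  simp only [TurningState, evenSite_add_vec]
  rcases hd with rfl | rfl <;> cases d <;> simp [Dir.left, Dir.right]

theorem turningState_left (x : ℤ × ℤ) (d : Dir) :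
    TurningState (x + d.left.vec, d.left) ↔ TurningState (x, d) :=
  turningState_turn x (Or.inl rfl)

theorem turningState_right (x : ℤ × ℤ) (d : Dir) :
    TurningState (x + d.right.vec, d.right) ↔ TurningState (x, d) :=
  turningState_turn x (Or.inr rfl)

theorem turningState_forward (x : ℤ × ℤ) (d : Dir) :
    TurningState (x + d.vec, d) ↔ ¬ TurningState (x, d) := by
  simp only [TurningState, evenSite_add_vec]
  cases d <;> simp

theorem forwardProb_of_turningState (ζ : ℤ × ℤ → Set.Icc (0 : ℝ) 1) {x : ℤ × ℤ} {d : Dir}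
    (h : TurningState (x, d)) : forwardProb ζ x d = 0 := by
  refine if_neg ?_
  simp only [TurningState] at h
  grind

theorem lintegral_stepKernel_of_turningState (ζ : ℤ × ℤ → Set.Icc (0 : ℝ) 1) {x : ℤ × ℤ} {d : Dir}
    (h : TurningState (x, d)) (f : State → ℝ≥0∞) :
    ∫⁻ t, f t ∂stepKernel (northSouthEnv ζ) (x, d) =
      2⁻¹ * (f (x + d.left.vec, d.left) + f (x + d.right.vec, d.right)) := by
  rw [lintegral_stepKernel_northSouthEnv, forwardProb_of_turningState ζ h, ENNReal.ofReal_zero,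
    zero_mul, zero_add, sub_zero, one_div, ENNReal.ofReal_inv_of_pos two_pos,
    ENNReal.ofReal_ofNat]

theorem isAbsorbing_turningState (ζ : ℤ × ℤ → Set.Icc (0 : ℝ) 1) :
    IsAbsorbing (stepKernel (northSouthEnv ζ)) {s | TurningState s} := by
  rintro ⟨x, d⟩ (h : TurningState (x, d))
  rw [ae_iff, ← lintegral_indicator_one (.of_discrete), lintegral_stepKernel_of_turningState ζ h]
  simp [turningState_left, turningState_right, h]

section Velocity

variable (c : ℤ × ℤ →+ ℤ) (l : ℝ)

/-- The exponential `exp (l c(x))` of a coordinate `c`, increased by the factor `exp |l|` outside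
the turning states. The factor is lost when the walker goes forward, which makes up for the lack of
symmetry of such a step. -/
noncomputable def expWeight (s : State) : ℝ :=
  Real.exp (l * c s.1) * if TurningState s then 1 else Real.exp |l|

theorem exp_le_expWeight (s : State) : Real.exp (l * c s.1) ≤ expWeight c l s := by
  refine le_mul_of_one_le_right (Real.exp_pos _).le ?_
  split_ifs
  exacts [le_rfl, Real.one_le_exp (abs_nonneg l)]

variable {c}

theorem abs_mul_coord_vec_le (hc : ∀ d : Dir, |c d.vec| ≤ 1) (d : Dir) :
    |l * c d.vec| ≤ |l| := by
  rw [abs_mul]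
  exact mul_le_of_le_one_right (abs_nonneg l) (by exact_mod_cast hc d)

theorem exp_coord_forward_le (hc : ∀ d : Dir, |c d.vec| ≤ 1) (x : ℤ × ℤ) (d : Dir) :
    Real.exp (l * c (x + d.vec)) ≤ Real.exp (l * c x) * Real.exp |l| := by
  rw [← Real.exp_add, Real.exp_le_exp, map_add, Int.cast_add, mul_add]
  gcongr
  exact (le_abs_self _).trans (abs_mul_coord_vec_le l hc d)

theorem exp_coord_turn_le (hc : ∀ d : Dir, |c d.vec| ≤ 1) (x : ℤ × ℤ) (d : Dir) :
    (Real.exp (l * c (x + d.left.vec)) + Real.exp (l * c (x + d.right.vec))) / 2 ≤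
      Real.exp (l * c x) * Real.cosh l := by
  calc (Real.exp (l * c (x + d.left.vec)) + Real.exp (l * c (x + d.right.vec))) / 2
    _ = Real.exp (l * c x) * Real.cosh (l * c d.left.vec) := by
      rw [Dir.vec_right, map_add, map_add, map_neg, Real.cosh_eq]
      push_cast
      rw [mul_add, mul_add, Real.exp_add, Real.exp_add, mul_neg]
      ring
    _ ≤ Real.exp (l * c x) * Real.cosh l := by
      gcongr
      exact Real.cosh_le_cosh.2 (abs_mul_coord_vec_le l hc _)

theorem mean_expWeight_le (ζ : ℤ × ℤ → Set.Icc (0 : ℝ) 1) (hc : ∀ d : Dir, |c d.vec| ≤ 1)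
    (x : ℤ × ℤ) (d : Dir) :
    forwardProb ζ x d * expWeight c l (x + d.vec, d) + (1 - forwardProb ζ x d) / 2 *
        (expWeight c l (x + d.left.vec, d.left) + expWeight c l (x + d.right.vec, d.right)) ≤
      Real.cosh l * expWeight c l (x, d) := by
  have h_turn := exp_coord_turn_le l hc x d
  by_cases hA : TurningState (x, d)
  · simp only [forwardProb_of_turningState ζ hA, expWeight, turningState_left,
      turningState_right, hA, if_true, mul_one]
    linarith
  · obtain ⟨hp0, hp1⟩ := forwardProb_mem ζ x d
    simp only [expWeight, turningState_left, turningState_right, hA,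
      (turningState_forward x d).2 hA, if_true, if_false, mul_one]
    have h_forward : Real.exp (l * c (x + d.vec)) ≤
        Real.exp (l * c x) * Real.exp |l| * Real.cosh l :=
      (exp_coord_forward_le l hc x d).trans
        (le_mul_of_one_le_right (by positivity) (Real.one_le_cosh l))
    have h_turn' := mul_le_mul_of_nonneg_right h_turn (Real.exp_pos |l|).le
    linarith [mul_le_mul_of_nonneg_left h_forward hp0,
      mul_le_mul_of_nonneg_left h_turn' (sub_nonneg.2 hp1)]

theorem isExpLyapunov_expWeight (ζ : ℤ × ℤ → Set.Icc (0 : ℝ) 1) (hc : ∀ d : Dir, |c d.vec| ≤ 1) :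
    IsExpLyapunov (stepKernel (northSouthEnv ζ)) (fun s => (c s.1 : ℝ)) l
      (fun s => ENNReal.ofReal (expWeight c l s)) where
  measurable := measurable_of_countable _
  ne_top _ := ENNReal.ofReal_ne_top
  exp_le s := ENNReal.ofReal_le_ofReal (exp_le_expWeight c l s)
  lintegral_le := by
    rintro ⟨x, d⟩
    have h_nonneg (s : State) : 0 ≤ expWeight c l s :=
      (Real.exp_pos _).le.trans (exp_le_expWeight c l s)
    obtain ⟨hp0, hp1⟩ := forwardProb_mem ζ x d
    have hq0 : 0 ≤ (1 - forwardProb ζ x d) / 2 := by linarith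
    rw [lintegral_stepKernel_northSouthEnv, ← ENNReal.ofReal_add (h_nonneg _) (h_nonneg _),
      ← ENNReal.ofReal_mul hp0, ← ENNReal.ofReal_mul hq0,
      ← ENNReal.ofReal_add (mul_nonneg hp0 (h_nonneg _))
        (mul_nonneg hq0 (add_nonneg (h_nonneg _) (h_nonneg _))),
      ← ENNReal.ofReal_mul (Real.exp_pos _).le]
    exact ENNReal.ofReal_le_ofReal ((mean_expWeight_le l ζ hc x d).trans
      (mul_le_mul_of_nonneg_right (Real.cosh_le_exp_half_sq l) (h_nonneg _)))

theorem hasAsymptoticVelocity_northSouthEnv (ζ : ℤ × ℤ → Set.Icc (0 : ℝ) 1) :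
    HasAsymptoticVelocity (northSouthEnv ζ) (0, 0) := by
  intro ξ
  have h_coord (c : ℤ × ℤ →+ ℤ) (hc : ∀ d : Dir, |c d.vec| ≤ 1) :
      ∀ᵐ Z ∂pathLaw (northSouthEnv ζ) ξ,
        Tendsto (fun n : ℕ => (c (Z n).1 : ℝ) / n) atTop (𝓝 0) :=
    ae_tendsto_div_zero_of_isExpLyapunov _ (fun l => ⟨_, isExpLyapunov_expWeight l ζ hc⟩) ξ
  filter_upwards [h_coord (AddMonoidHom.fst ℤ ℤ) (by decide),
    h_coord (AddMonoidHom.snd ℤ ℤ) (by decide)] with Z h_fst h_snd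
  exact h_fst.prodMk_nhds h_snd

end Velocity

section Recurrence

/-- The number of nearest-neighbour paths of length `k` in `ℤ` from `0` to `j`. -/
def walkCount : ℕ → ℤ → ℕ
  | 0, j => if j = 0 then 1 else 0
  | k + 1, j => walkCount k (j - 1) + walkCount k (j + 1)

theorem choose_le_walkCount (k i : ℕ) : k.choose i ≤ walkCount k (k - 2 * i) := by
  induction k generalizing i with
  | zero => cases i <;> simp [walkCount]
  | succ k ih =>
    have h_prev (i : ℕ) : ((k + 1 : ℕ) : ℤ) - 2 * i - 1 = k - 2 * i := by push_cast; ring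
    have h_next (i : ℕ) : ((k + 1 : ℕ) : ℤ) - 2 * (i + 1 : ℕ) + 1 = k - 2 * i := by
      push_cast; ring
    cases i with
    | zero =>
      rw [walkCount, h_prev, Nat.choose_zero_right]
      exact (k.choose_zero_right ▸ ih 0).trans (Nat.le_add_right _ _)
    | succ i =>
      rw [walkCount, h_prev, h_next, Nat.choose_succ_succ', add_comm]
      exact add_le_add (ih (i + 1)) (ih i)

theorem centralBinom_succ_le_two_mul_walkCount (m : ℕ) {j : ℤ} (hj : j = 1 ∨ j = -1) :
    (m + 1).centralBinom ≤ 2 * walkCount (2 * m + 1) j := by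
  have h_choose : (m + 1).centralBinom = 2 * (2 * m + 1).choose m := by
    rw [Nat.centralBinom, show 2 * (m + 1) = 2 * m + 1 + 1 by ring, Nat.choose_succ_succ,
      Nat.choose_symm_half]
    ring
  rw [h_choose]
  gcongr
  rcases hj with rfl | rfl
  · have h := choose_le_walkCount (2 * m + 1) m
    rwa [show ((2 * m + 1 : ℕ) : ℤ) - 2 * m = 1 by push_cast; ring] at h
  · have h := choose_le_walkCount (2 * m + 1) (m + 1)
    rwa [Nat.choose_symm_half,
      show ((2 * m + 1 : ℕ) : ℤ) - 2 * (m + 1 : ℕ) = -1 by push_cast; ring] at h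

theorem sixteen_pow_succ_le_centralBinom_sq (m : ℕ) :
    16 ^ (m + 1) ≤ 4 * (m + 1) * (m + 1).centralBinom ^ 2 := by
  induction m with
  | zero => decide
  | succ m ih =>
    have h_rec : (m + 2) * (m + 2).centralBinom = 2 * (2 * m + 3) * (m + 1).centralBinom :=
      Nat.succ_mul_centralBinom_succ (m + 1)
    refine le_of_mul_le_mul_left (a := (m + 2) ^ 2) ?_ (by positivity)
    calc (m + 2) ^ 2 * 16 ^ (m + 2)
      _ ≤ (m + 2) ^ 2 * 16 * (4 * (m + 1) * (m + 1).centralBinom ^ 2) := by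
        rw [pow_succ' 16 (m + 1), ← mul_assoc]
        gcongr
      _ = 16 * ((m + 1) * (m + 2)) * (4 * (m + 2) * (m + 1).centralBinom ^ 2) := by ring
      _ ≤ 4 * (2 * m + 3) ^ 2 * (4 * (m + 2) * (m + 1).centralBinom ^ 2) := by
        refine Nat.mul_le_mul_right _ ?_
        nlinarith
      _ = 4 * (m + 2) * (2 * (2 * m + 3) * (m + 1).centralBinom) ^ 2 := by ring
      _ = (m + 2) ^ 2 * (4 * (m + 2) * (m + 2).centralBinom ^ 2) := by rw [← h_rec]; ring

theorem sixteen_pow_succ_le_walkCount_mul_walkCount (m : ℕ) {i j : ℤ} (hi : i = 1 ∨ i = -1)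
    (hj : j = 1 ∨ j = -1) :
    16 ^ (m + 1) ≤ walkCount (2 * m + 1) i * walkCount (2 * m + 1) j * (16 * (m + 1)) := by
  have h_i := centralBinom_succ_le_two_mul_walkCount m hi
  have h_j := centralBinom_succ_le_two_mul_walkCount m hj
  calc 16 ^ (m + 1)
    _ ≤ 4 * (m + 1) * ((m + 1).centralBinom * (m + 1).centralBinom) := by
      rw [← sq]
      exact sixteen_pow_succ_le_centralBinom_sq m
    _ ≤ 4 * (m + 1) * (2 * walkCount (2 * m + 1) i * (2 * walkCount (2 * m + 1) j)) := by gcongr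
    _ = walkCount (2 * m + 1) i * walkCount (2 * m + 1) j * (16 * (m + 1)) := by ring

variable (ζ : ℤ × ℤ → Set.Icc (0 : ℝ) 1)

theorem stepKernel_pow_succ_apply_of_turningState {x : ℤ × ℤ} {d : Dir}
    (h : TurningState (x, d)) (n : ℕ) (A : Set State) :
    (stepKernel (northSouthEnv ζ) ^ (n + 1)) (x, d) A =
      2⁻¹ * ((stepKernel (northSouthEnv ζ) ^ n) (x + d.left.vec, d.left) A +
        (stepKernel (northSouthEnv ζ) ^ n) (x + d.right.vec, d.right) A) := by
  rw [add_comm, Kernel.pow_add_apply_eq_lintegral _ 1 n _ (.of_discrete), pow_one,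
    lintegral_stepKernel_of_turningState ζ h]

theorem stepKernel_pow_two_mul_apply_turningState (y : ℤ × ℤ) (k : ℕ) {s : State}
    (hs : TurningState s) :
    (stepKernel (northSouthEnv ζ) ^ (2 * k)) s {t | TurningState t ∧ t.1 = y} =
      walkCount k (y.1 - s.1.1) * walkCount k (y.2 - s.1.2) * 2⁻¹ ^ (2 * k) := by
  induction k generalizing s with
  | zero =>
    refine (Measure.dirac_apply' s .of_discrete).trans ?_
    simp [walkCount, Set.indicator_apply, hs, Prod.ext_iff, sub_eq_zero, eq_comm, ← ite_and,
      and_comm]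
  | succ k ih =>
    obtain ⟨x, d⟩ := s
    have hl := (turningState_left x d).2 hs
    have hr := (turningState_right x d).2 hs
    -- Of two consecutive turns one is horizontal and the other vertical.
    rw [show 2 * (k + 1) = 2 * k + 1 + 1 by ring, stepKernel_pow_succ_apply_of_turningState ζ hs,
      stepKernel_pow_succ_apply_of_turningState ζ hl,
      stepKernel_pow_succ_apply_of_turningState ζ hr,
      ih ((turningState_left _ _).2 hl), ih ((turningState_right _ _).2 hl),
      ih ((turningState_left _ _).2 hr), ih ((turningState_right _ _).2 hr)]
    cases d <;> simp [Dir.left, Dir.right, Dir.vec, walkCount, sub_add_eq_sub_sub] <;> ring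

theorem half_mul_stepKernel_pow_le {x : ℤ × ℤ} {d d' : Dir} (h : TurningState (x, d))
    (hd : d' = d.left ∨ d' = d.right) (n : ℕ) (A : Set State) :
    2⁻¹ * (stepKernel (northSouthEnv ζ) ^ n) (x + d'.vec, d') A ≤
      (stepKernel (northSouthEnv ζ) ^ (n + 1)) (x, d) A := by
  rw [stepKernel_pow_succ_apply_of_turningState ζ h]
  gcongr
  rcases hd with rfl | rfl
  exacts [le_self_add, le_add_self]

theorem inv_four_le_stepKernel_sq_apply_singleton {x x₀ : ℤ × ℤ} {d d₀ : Dir}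
    (h : TurningState (x, d)) (h₀ : TurningState (x₀, d₀)) (hx : x + d₀.left.vec + d₀.vec = x₀) :
    2⁻¹ ^ 2 ≤ (stepKernel (northSouthEnv ζ) ^ 2) (x, d) {(x₀, d₀)} := by
  subst hx
  have h_second : d₀ = d₀.left.left ∨ d₀ = d₀.left.right := by
    cases d₀ <;> simp [Dir.left, Dir.right]
  have h_mid : TurningState (x + d₀.left.vec, d₀.left) := (turningState_turn _ h_second).1 h₀
  have h_first : d₀.left = d.left ∨ d₀.left = d.right := by
    simp only [TurningState, evenSite_add_vec, not_not] at h h₀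
    by_cases hE : EvenSite x <;> cases d <;> cases d₀ <;> simp_all [Dir.left, Dir.right]
  have h_end : (stepKernel (northSouthEnv ζ) ^ 0) (x + d₀.left.vec + d₀.vec, d₀)
      {(x + d₀.left.vec + d₀.vec, d₀)} = 1 := Measure.dirac_apply_of_mem rfl
  calc (2⁻¹ : ℝ≥0∞) ^ 2
    _ = 2⁻¹ * (2⁻¹ * (stepKernel (northSouthEnv ζ) ^ 0) (x + d₀.left.vec + d₀.vec, d₀)
        {(x + d₀.left.vec + d₀.vec, d₀)}) := by rw [h_end, mul_one, sq]
    _ ≤ 2⁻¹ * (stepKernel (northSouthEnv ζ) ^ 1) (x + d₀.left.vec, d₀.left)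
        {(x + d₀.left.vec + d₀.vec, d₀)} := by
      gcongr
      exact half_mul_stepKernel_pow_le ζ h_mid h_second 0 _
    _ ≤ (stepKernel (northSouthEnv ζ) ^ 2) (x, d) {(x + d₀.left.vec + d₀.vec, d₀)} :=
      half_mul_stepKernel_pow_le ζ h h_first 1 _

theorem inv_le_stepKernel_pow_apply_self {ξ : State} (hξ : TurningState ξ) (m : ℕ) :
    (16 * (m + 1 : ℝ≥0∞))⁻¹ ≤ (stepKernel (northSouthEnv ζ) ^ (4 * m + 4)) ξ {ξ} := by
  obtain ⟨x₀, d₀⟩ := ξ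
  let y := x₀ - d₀.vec - d₀.left.vec
  let W := walkCount (2 * m + 1) (y.1 - x₀.1) * walkCount (2 * m + 1) (y.2 - x₀.2)
  have h_return : 2⁻¹ ^ 2 * (W * 2⁻¹ ^ (2 * (2 * m + 1))) ≤
      (stepKernel (northSouthEnv ζ) ^ (4 * m + 4)) (x₀, d₀) {(x₀, d₀)} := by
    have h := mul_pow_apply_le_pow_add_apply (stepKernel (northSouthEnv ζ)) (m := 2 * (2 * m + 1))
      (n := 2) (A := {t | TurningState t ∧ t.1 = y}) (B := {(x₀, d₀)}) (c := 2⁻¹ ^ 2)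
      .of_discrete .of_discrete ?_ (x₀, d₀)
    · rwa [stepKernel_pow_two_mul_apply_turningState ζ y _ hξ, ← Nat.cast_mul,
        show 2 * (2 * m + 1) + 2 = 4 * m + 4 by ring] at h
    · rintro ⟨x, d⟩ ⟨h, rfl : x = y⟩
      exact inv_four_le_stepKernel_sq_apply_singleton ζ h hξ (by simp only [y]; abel)
  have h_count : 16 ^ (m + 1) ≤ W * (16 * (m + 1)) :=
    sixteen_pow_succ_le_walkCount_mul_walkCount m
      (by cases d₀ <;> simp [y, Dir.vec, Dir.left]) (by cases d₀ <;> simp [y, Dir.vec, Dir.left])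
  refine le_trans ?_ h_return
  have h_pow : (2⁻¹ : ℝ≥0∞) ^ 2 * (W * 2⁻¹ ^ (2 * (2 * m + 1))) = W / 16 ^ (m + 1) := by
    rw [mul_left_comm, ← pow_add, show 2 + 2 * (2 * m + 1) = 4 * (m + 1) by ring, pow_mul,
      ← ENNReal.inv_pow, ← ENNReal.inv_pow, div_eq_mul_inv]
    norm_num
  rw [h_pow, ENNReal.le_div_iff_mul_le (by simp) (by simp), mul_comm, ← div_eq_mul_inv]
  refine ENNReal.div_le_of_le_mul ?_
  exact_mod_cast h_count

theorem tsum_inv_natCast_add_one_eq_top : ∑' m : ℕ, (m + 1 : ℝ≥0∞)⁻¹ = ∞ := by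
  have h_coe (m : ℕ) : (m + 1 : ℝ≥0∞)⁻¹ = ((m + 1 : NNReal)⁻¹ : NNReal) := by
    rw [ENNReal.coe_inv (by positivity)]
    simp
  rw [tsum_congr h_coe, ENNReal.tsum_coe_eq_top_iff_not_summable_coe]
  intro h
  exact Real.not_summable_natCast_inv ((summable_nat_add_iff 1).1 (by simpa using h))

theorem tsum_stepKernel_pow_apply_self_eq_top {ξ : State} (hξ : TurningState ξ) :
    ∑' n, (stepKernel (northSouthEnv ζ) ^ n) ξ {ξ} = ∞ := by
  have h_inj : Function.Injective fun m : ℕ => 4 * m + 4 := fun a b h => by lia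
  refine top_unique ?_
  calc ∞
    _ = ∑' m : ℕ, (16 * (m + 1 : ℝ≥0∞))⁻¹ := by
      simp_rw [ENNReal.mul_inv (a := 16) (.inl (by norm_num)) (.inl (by norm_num))]
      rw [ENNReal.tsum_mul_left, tsum_inv_natCast_add_one_eq_top, ENNReal.mul_top (by simp)]
    _ ≤ ∑' m : ℕ, (stepKernel (northSouthEnv ζ) ^ (4 * m + 4)) ξ {ξ} :=
      ENNReal.tsum_le_tsum (inv_le_stepKernel_pow_apply_self ζ hξ)
    _ ≤ ∑' n, (stepKernel (northSouthEnv ζ) ^ n) ξ {ξ} :=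
      ENNReal.tsum_comp_le_tsum_of_injective h_inj _

theorem recurrentFrom_of_turningState {ξ : State} (hξ : TurningState ξ) :
    RecurrentFrom (northSouthEnv ζ) ξ :=
  (recurrentFrom_iff_escapeProb_eq_zero _ _).2
    (escapeProb_eq_zero _ (tsum_stepKernel_pow_apply_self_eq_top ζ hξ))

end Recurrence

section NonRecurrence

theorem stepKernel_apply_singleton (ω : Env) (x : ℤ × ℤ) (d d' : Dir) :
    stepKernel ω (x, d) {(x + d'.vec, d')} =
      ENNReal.ofReal ((ω x : Matrix Dir Dir ℝ) d d') := by
  rw [← lintegral_indicator_one (measurableSet_singleton _), lintegral_stepKernel,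
    Finset.sum_eq_single_of_mem d' (Finset.mem_univ d')]
  · simp
  · intro b _ hb
    simp [hb]

variable {ζ : ℤ × ℤ → Set.Icc (0 : ℝ) 1}

theorem stepKernel_forward_pos {x : ℤ × ℤ} {d : Dir} (h : 0 < forwardProb ζ x d) :
    0 < stepKernel (northSouthEnv ζ) (x, d) {(x + d.vec, d)} := by
  rw [stepKernel_apply_singleton, ENNReal.ofReal_pos]
  simpa [northSouthEnv, forwardMatrix, Dir.forward] using h

theorem stepKernel_turn_pos {x : ℤ × ℤ} {d d' : Dir} (hd : d' = d.left ∨ d' = d.right)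
    (h : forwardProb ζ x d < 1) :
    0 < stepKernel (northSouthEnv ζ) (x, d) {(x + d'.vec, d')} := by
  have h_ne : d' ≠ d.forward := by
    rcases hd with rfl | rfl <;> cases d <;> decide
  rw [stepKernel_apply_singleton, ENNReal.ofReal_pos]
  simpa [northSouthEnv, forwardMatrix, h_ne, hd] using h

variable (ζ) in
/-- Some turning state is accessible from `s`. -/
def ReachesTurning (s : State) : Prop :=
  ∃ t, TurningState t ∧ IsAccessible (stepKernel (northSouthEnv ζ)) s t

namespace ReachesTurning

theorem of_forwardProb_pos {x : ℤ × ℤ} {d : Dir} (h : 0 < forwardProb ζ x d) :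
    ReachesTurning ζ (x, d) :=
  ⟨(x + d.vec, d),
    (turningState_forward x d).2 fun h_turn => h.ne' (forwardProb_of_turningState ζ h_turn),
    Relation.ReflTransGen.single (stepKernel_forward_pos h)⟩

theorem of_turn {x : ℤ × ℤ} {d d' : Dir} (hd : d' = d.left ∨ d' = d.right)
    (h : ReachesTurning ζ (x + d'.vec, d')) : ReachesTurning ζ (x, d) := by
  rcases (forwardProb_mem ζ x d).1.eq_or_lt with h_zero | h_pos
  · obtain ⟨t, ht, h_acc⟩ := h
    exact ⟨t, ht, .head (stepKernel_turn_pos hd (h_zero ▸ one_pos)) h_acc⟩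
  · exact .of_forwardProb_pos h_pos

theorem of_evenSite_of_dist_lt {x : ℤ × ℤ} (hx : EvenSite x) (hζx : 0 < (ζ x : ℝ)) (n : ℕ)
    {y : ℤ × ℤ} (hy : EvenSite y) (h_fst : (y.1 - x.1).natAbs < n) (h_snd : (y.2 - x.2).natAbs < n)
    {d : Dir} (hd : d = Dir.north ∨ d = Dir.south) : ReachesTurning ζ (y, d) := by
  induction n generalizing y d with
  | zero => exact absurd h_fst (Nat.not_lt_zero _)
  | succ n ih =>
    rcases eq_or_ne y x with rfl | hyx
    · exact .of_forwardProb_pos (hζx.trans_eq (if_pos ⟨hx, hd⟩).symm)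
    -- The site `x` is even: on a coordinate axis through `x`, no even site is at distance `1`.
    have h_far : 1 < n ∨ y.1 ≠ x.1 ∧ y.2 ≠ x.2 := by
      rw [Ne, Prod.ext_iff] at hyx
      rw [EvenSite, Int.even_iff] at hx hy
      lia
    obtain ⟨d₁, hd₁, h_fst'⟩ : ∃ d₁, (d₁ = Dir.east ∨ d₁ = Dir.west) ∧
        (y.1 + d₁.vec.1 - x.1).natAbs < n := by
      rcases lt_or_ge x.1 y.1 with h | h
      exacts [⟨.west, by simp, by simp only [Dir.vec]; lia⟩,
        ⟨.east, by simp, by simp only [Dir.vec]; lia⟩]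
    obtain ⟨d₂, hd₂, h_snd'⟩ : ∃ d₂, (d₂ = Dir.north ∨ d₂ = Dir.south) ∧
        (y.2 + d₂.vec.2 - x.2).natAbs < n := by
      rcases lt_or_ge x.2 y.2 with h | h
      exacts [⟨.south, by simp, by simp only [Dir.vec]; lia⟩,
        ⟨.north, by simp, by simp only [Dir.vec]; lia⟩]
    have h_end : ReachesTurning ζ (y + d₁.vec + d₂.vec, d₂) := by
      refine ih ?_ ?_ ?_ hd₂
      · rwa [evenSite_add_vec, evenSite_add_vec, not_not]
      · rcases hd₂ with rfl | rfl <;> simpa [Dir.vec] using h_fst'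
      · rcases hd₁ with rfl | rfl <;> simpa [Dir.vec] using h_snd'
    refine .of_turn (d' := d₁) ?_ (.of_turn (d' := d₂) ?_ h_end)
    · rcases hd with rfl | rfl <;> rcases hd₁ with rfl | rfl <;> decide
    · rcases hd₁ with rfl | rfl <;> rcases hd₂ with rfl | rfl <;> decide

end ReachesTurning

theorem reachesTurning (hζ : ∃ x, EvenSite x ∧ 0 < (ζ x : ℝ)) (s : State) :
    ReachesTurning ζ s := by
  obtain ⟨x, hx, hζx⟩ := hζ
  have h_vertical {y : ℤ × ℤ} (hy : EvenSite y) {d : Dir} (hd : d = Dir.north ∨ d = Dir.south) :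
      ReachesTurning ζ (y, d) :=
    .of_evenSite_of_dist_lt hx hζx (max (y.1 - x.1).natAbs (y.2 - x.2).natAbs + 1) hy
      (by lia) (by lia) hd
  obtain ⟨y, d⟩ := s
  by_cases hs : TurningState (y, d)
  · exact ⟨_, hs, .refl⟩
  by_cases hy : EvenSite y
  · exact h_vertical hy (by cases d <;> simp_all [TurningState])
  · exact .of_turn (.inl rfl) (h_vertical ((evenSite_add_vec y _).2 hy)
      (by cases d <;> simp_all [TurningState, Dir.left]))

theorem not_recurrentFrom_of_not_turningState (hζ : ∃ x, EvenSite x ∧ 0 < (ζ x : ℝ)) {ξ : State}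
    (hξ : ¬ TurningState ξ) : ¬ RecurrentFrom (northSouthEnv ζ) ξ := by
  obtain ⟨t, ht, h_acc⟩ := reachesTurning hζ ξ
  have h_escape : escapeProb (stepKernel (northSouthEnv ζ)) ξ t = 1 :=
    (isAbsorbing_turningState ζ).escapeProb_eq_one .of_discrete ht hξ
  rw [recurrentFrom_iff_escapeProb_eq_zero]
  exact (h_acc.escapeProb_pos (h_escape ▸ one_pos)).ne'

end NonRecurrence

end PersistentWalk

theorem mainTheorem5 (ζ : ℤ × ℤ → Set.Icc (0 : ℝ) 1)
    (hζ : ∃ x : ℤ × ℤ, PersistentWalk.EvenSite x ∧ 0 < (ζ x : ℝ)) :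
    (∀ (x₀ : ℤ × ℤ) (d₀ : PersistentWalk.Dir),
      ((PersistentWalk.EvenSite x₀ ∧
          (d₀ = PersistentWalk.Dir.east ∨ d₀ = PersistentWalk.Dir.west)) ∨
        (¬ PersistentWalk.EvenSite x₀ ∧
          (d₀ = PersistentWalk.Dir.north ∨ d₀ = PersistentWalk.Dir.south)) →
        PersistentWalk.RecurrentFrom (PersistentWalk.northSouthEnv ζ) (x₀, d₀)) ∧
      (¬ ((PersistentWalk.EvenSite x₀ ∧
          (d₀ = PersistentWalk.Dir.east ∨ d₀ = PersistentWalk.Dir.west)) ∨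
        (¬ PersistentWalk.EvenSite x₀ ∧
          (d₀ = PersistentWalk.Dir.north ∨ d₀ = PersistentWalk.Dir.south))) →
        ¬ PersistentWalk.RecurrentFrom (PersistentWalk.northSouthEnv ζ) (x₀, d₀))) ∧
    PersistentWalk.HasAsymptoticVelocity (PersistentWalk.northSouthEnv ζ) (0, 0) :=
  ⟨fun _ _ => ⟨fun h => PersistentWalk.recurrentFrom_of_turningState ζ h,
      fun h => PersistentWalk.not_recurrentFrom_of_not_turningState hζ h⟩,
    PersistentWalk.hasAsymptoticVelocity_northSouthEnv ζ⟩
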